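/- A SAT oracle for formulas over $n$ propositional variables is a map $O$ that sends each satisfiable Boolean formula $\chi$ over these variables to some satisfying assignment of $\chi$, and each unsatisfiable one to $\bot$; nothing else about its answers is guaranteed. Consider randomized adaptive algorithms whose only access to the input formula $\varphi$ over $n$ variables is through oracle queries of the form $\varphi\wedge\psi_A$, where $A\subseteq\{T,F\}^n$ is an arbitrary set that may depend on the previous answers and on the internal randomness, and $\psi_A$ is a formula over the same $n$ variables whose set of satisfying assignments is $A$. Write $\mathrm{sol}(\varphi)$ for the set of satisfying assignments of $\varphi$. Such an algorithm computes an $(\varepsilon,\delta)$-approximation of the model count if, for every formula $\varphi$ over $n$ variables and every SAT oracle, its output $\mathrm{Est}$ satisfies $$\Pr\left[\frac{|\mathrm{sol}(\varphi)|}{1+\varepsilon}\le \mathrm{Est}\le (1+\varepsilon)\,|\mathrm{sol}(\varphi)|\right]\ge 1-\delta ,$$ the probability being over the internal randomness of the algorithm. **Theorem.** For all $\varepsilon,\delta\in(0,1)$ there are $c>0$ and $N$ such that for every $n\ge N$, every such algorithm that computes an $(\varepsilon,\delta)$-approximation of the model count for formulas over $n$ variables and that always makes at most $q$ oracle queries satisfies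 $$q\ \ge\ c\,\frac{\log n}{\log\log n}.$$ -/

import Mathlib

open MeasureTheory

/-- Truth assignments to the propositional variables `v_0, …, v_{n-1}`. -/
abbrev Assignment (n : ℕ) : Type := Fin n → Bool

/-- Boolean formulas over `n` propositional variables. -/
inductive BoolFormula (n : ℕ) : Type
  | const (b : Bool) : BoolFormula n
  | var (i : Fin n) : BoolFormula n
  | neg (φ : BoolFormula n) : BoolFormula n
  | and (φ ψ : BoolFormula n) : BoolFormula n
  | or (φ ψ : BoolFormula n) : BoolFormula n

namespace BoolFormula

/-- The truth value of a formula under an assignment. -/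
def eval {n : ℕ} : BoolFormula n → Assignment n → Bool
  | const b, _ => b
  | var i, s => s i
  | neg φ, s => !(φ.eval s)
  | and φ ψ, s => φ.eval s && ψ.eval s
  | or φ ψ, s => φ.eval s || ψ.eval s

/-- `sol φ`: the set of satisfying assignments of `φ`. -/
def sol {n : ℕ} (φ : BoolFormula n) : Finset (Assignment n) :=
  Finset.univ.filter fun s => φ.eval s = true

/-- Every set `A` of assignments is the solution set of some formula `ψ_A`, so that asking about
`φ ∧ ψ` for arbitrary formulas `ψ` is asking about `sol φ ∩ A` for arbitrary sets `A`. -/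
theorem exists_sol_eq {n : ℕ} (A : Finset (Assignment n)) : ∃ ψ : BoolFormula n, ψ.sol = A := by
  classical
  have key : ∀ (a : Assignment n) (I : Finset (Fin n)),
      ∃ ψ : BoolFormula n, ∀ s, ψ.eval s = true ↔ ∀ i ∈ I, s i = a i := by
    intro a I
    induction I using Finset.induction_on with
    | empty => exact ⟨const true, by simp [eval]⟩
    | insert i I _ ih =>
      obtain ⟨ψ, hψ⟩ := ih
      cases h : a i with
      | true => exact ⟨and (var i) ψ, by simp [eval, hψ, h]⟩
      | false => exact ⟨and (neg (var i)) ψ, by simp [eval, hψ, h]⟩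
  induction A using Finset.induction_on with
  | empty => exact ⟨const false, by simp [sol, eval]⟩
  | insert a A _ ih =>
    obtain ⟨ψ, hψ⟩ := ih
    obtain ⟨χ, hχ⟩ := key a Finset.univ
    refine ⟨or χ ψ, ?_⟩
    ext s
    rw [← hψ]
    simp [sol, eval, hχ, funext_iff]

end BoolFormula

/-- `O` is a SAT oracle: on a satisfiable formula it returns some satisfying assignment of it, and
on an unsatisfiable formula it returns `⊥` (here `none`). Nothing else is known about its answers. -/
def IsSATOracle {n : ℕ} (O : BoolFormula n → Option (Assignment n)) : Prop :=
  ∀ φ : BoolFormula n,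
    (φ.sol.Nonempty → ∃ s ∈ φ.sol, O φ = some s) ∧ (φ.sol = ∅ → O φ = none)

/-- A deterministic adaptive algorithm on inputs with `n` variables, as a decision tree: it either
stops with a real estimate, or chooses a formula `ψ`, has the oracle asked about `φ ∧ ψ`, where `φ`
is the input formula, and continues depending on the answer. It has no other access to `φ`. -/
inductive QueryTree (n : ℕ) : Type
  | output (est : ℝ) : QueryTree n
  | query (ψ : BoolFormula n) (next : Option (Assignment n) → QueryTree n) : QueryTree n

namespace QueryTree

/-- The estimate that is returned on input `φ` when the oracle is `O`. -/
def estimate {n : ℕ} (O : BoolFormula n → Option (Assignment n)) (φ : BoolFormula n) :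
    QueryTree n → ℝ
  | output est => est
  | query ψ next => (next (O (φ.and ψ))).estimate O φ

/-- The number of oracle queries made on input `φ` when the oracle is `O`. -/
def numQueries {n : ℕ} (O : BoolFormula n → Option (Assignment n)) (φ : BoolFormula n) :
    QueryTree n → ℕ
  | output _ => 0
  | query ψ next => (next (O (φ.and ψ))).numQueries O φ + 1

end QueryTree

/-- A randomized adaptive algorithm: a deterministic one for each value of the internal randomness
`ω : Ω`, such that the estimate is a random variable. -/
structure RandomizedCounter (n : ℕ) (Ω : Type*) [MeasurableSpace Ω] where
  tree : Ω → QueryTree n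
  measurable_estimate : ∀ (O : BoolFormula n → Option (Assignment n)), IsSATOracle O →
    ∀ φ : BoolFormula n, Measurable fun ω => (tree ω).estimate O φ

namespace RandomizedCounter

/-- The algorithm never makes more than `q` oracle queries. -/
def MakesAtMost {n : ℕ} {Ω : Type*} [MeasurableSpace Ω] (alg : RandomizedCounter n Ω)
    (q : ℕ) : Prop :=
  ∀ (O : BoolFormula n → Option (Assignment n)), IsSATOracle O →
    ∀ (φ : BoolFormula n) (ω : Ω), (alg.tree ω).numQueries O φ ≤ q

/-- The algorithm computes an `(ε, δ)`-approximation of `|sol φ|` for every input formula `φ`,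
whichever SAT oracle it is given; the probability is over its internal randomness. -/
def Approximates {n : ℕ} {Ω : Type*} [MeasurableSpace Ω] (alg : RandomizedCounter n Ω)
    (μ : Measure Ω) (ε δ : ℝ) : Prop :=
  ∀ (O : BoolFormula n → Option (Assignment n)), IsSATOracle O → ∀ φ : BoolFormula n,
    1 - δ ≤ μ.real {ω | (φ.sol.card : ℝ) / (1 + ε) ≤ (alg.tree ω).estimate O φ ∧
      (alg.tree ω).estimate O φ ≤ (1 + ε) * (φ.sol.card : ℝ)}

end RandomizedCounter

namespace BoolFormula

/-! A single benign-looking oracle already defeats every algorithm: it always returns the solution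
of least rank. On inputs whose solutions form an initial segment, an answer is either `none` or the
first solution of `ψ`, so it carries at most one bit (`firstSolution_and_of_initial`). For fixed
randomness, `q` queries thus give at most `2 ^ q` estimates (`QueryTree.card_image_estimate_le`).
Segments of sizes `4 ^ j`, `j ≤ n / 2`, need pairwise different estimates, so averaging the number
of successes over the randomness gives `(n / 2 + 1) * (1 - δ) ≤ 2 ^ q`. This is a bound of order
`log n`, stronger than the one claimed. -/

theorem sol_and {n : ℕ} (φ ψ : BoolFormula n) : (φ.and ψ).sol = φ.sol ∩ ψ.sol := by
  ext s
  simp [sol, eval]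

end BoolFormula

/-- The position of an assignment in a fixed enumeration of all assignments. -/
noncomputable def Assignment.rank {n : ℕ} (s : Assignment n) : ℕ :=
  (Fintype.equivFin (Assignment n) s : ℕ)

theorem Assignment.rank_injective (n : ℕ) : Function.Injective (Assignment.rank (n := n)) :=
  fun _ _ h => (Fintype.equivFin (Assignment n)).injective (Fin.ext h)

/-- The first `m` assignments of the enumeration. -/
noncomputable def initialAssignments (n m : ℕ) : Finset (Assignment n) :=
  Finset.univ.filter fun s => Assignment.rank s < m

theorem mem_initialAssignments {n m : ℕ} {s : Assignment n} :
    s ∈ initialAssignments n m ↔ Assignment.rank s < m := by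
  simp [initialAssignments]

theorem card_initialAssignments {n m : ℕ} (hm : m ≤ 2 ^ n) :
    (initialAssignments n m).card = m := by
  have hcard : Fintype.card (Assignment n) = 2 ^ n := by simp
  have himage : (initialAssignments n m).image Assignment.rank = Finset.range m := by
    ext k
    simp only [Finset.mem_image, mem_initialAssignments, Finset.mem_range]
    constructor
    · rintro ⟨s, hs, rfl⟩
      exact hs
    · intro hk
      refine ⟨(Fintype.equivFin (Assignment n)).symm ⟨k, by omega⟩, ?_, ?_⟩ <;>
        simp [Assignment.rank, hk]
  rw [← Finset.card_image_of_injective _ (Assignment.rank_injective n), himage, Finset.card_range]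

open Classical in
/-- The SAT oracle that returns the satisfying assignment of least rank. -/
noncomputable def firstSolution {n : ℕ} (χ : BoolFormula n) : Option (Assignment n) :=
  if h : χ.sol.Nonempty then
    some (Finset.exists_min_image χ.sol Assignment.rank h).choose
  else none

/-- Ranks are injective, so the minimizer is unique and the choice in `firstSolution` is immaterial.
-/
theorem firstSolution_eq_some {n : ℕ} {χ : BoolFormula n} {s : Assignment n} (hs : s ∈ χ.sol)
    (hmin : ∀ t ∈ χ.sol, s.rank ≤ t.rank) : firstSolution χ = some s := by
  have hne : χ.sol.Nonempty := ⟨s, hs⟩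
  have hspec := (Finset.exists_min_image χ.sol Assignment.rank hne).choose_spec
  rw [firstSolution, dif_pos hne, Option.some_inj]
  exact Assignment.rank_injective n (le_antisymm (hspec.2 s hs) (hmin _ hspec.1))

theorem firstSolution_eq_none {n : ℕ} {χ : BoolFormula n} (h : χ.sol = ∅) :
    firstSolution χ = none := by
  simp [firstSolution, h]

theorem isSATOracle_firstSolution (n : ℕ) : IsSATOracle (firstSolution (n := n)) := by
  refine fun χ => ⟨fun hne => ?_, firstSolution_eq_none⟩
  obtain ⟨s, hs, hmin⟩ := Finset.exists_min_image χ.sol Assignment.rank hne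
  exact ⟨s, hs, firstSolution_eq_some hs hmin⟩

/-- When the solutions of the input form an initial segment, a query has only two possible
answers, whatever the length of that segment. -/
theorem firstSolution_and_of_initial {n m : ℕ} {φ : BoolFormula n}
    (hφ : φ.sol = initialAssignments n m) (ψ : BoolFormula n) :
    firstSolution (φ.and ψ) = none ∨ firstSolution (φ.and ψ) = firstSolution ψ := by
  rcases (φ.and ψ).sol.eq_empty_or_nonempty with h | ⟨t, ht⟩
  · exact Or.inl (firstSolution_eq_none h)
  · right
    rw [BoolFormula.sol_and, hφ, Finset.mem_inter, mem_initialAssignments] at ht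
    -- The least solution of `ψ` ranks no higher than `t`, so it also lies in the segment.
    obtain ⟨s, hs, hmin⟩ := Finset.exists_min_image ψ.sol Assignment.rank ⟨t, ht.2⟩
    rw [firstSolution_eq_some hs hmin]
    refine firstSolution_eq_some ?_ fun r hr => hmin r ?_
    · rw [BoolFormula.sol_and, hφ, Finset.mem_inter, mem_initialAssignments]
      exact ⟨(hmin t ht.2).trans_lt ht.1, hs⟩
    · rw [BoolFormula.sol_and] at hr
      exact (Finset.mem_inter.1 hr).2

/-- If every query has at most two possible answers on a family of inputs, then `q` queries lead
to at most `2 ^ q` different estimates on that family. -/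
theorem QueryTree.card_image_estimate_le {n : ℕ} {ι : Type*}
    (O : BoolFormula n → Option (Assignment n)) (Φ : ι → BoolFormula n)
    (hΦ : ∀ i ψ, O ((Φ i).and ψ) = none ∨ O ((Φ i).and ψ) = O ψ)
    (T : QueryTree n) (q : ℕ) (I : Finset ι) (hq : ∀ i ∈ I, T.numQueries O (Φ i) ≤ q) :
    (I.image fun i => T.estimate O (Φ i)).card ≤ 2 ^ q := by
  classical
  induction T generalizing q I with
  | output est =>
    calc _ ≤ ({est} : Finset ℝ).card := Finset.card_le_card fun x hx => by
            obtain ⟨i, -, rfl⟩ := Finset.mem_image.1 hx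
            simp [estimate]
      _ ≤ 2 ^ q := by simpa using Nat.one_le_two_pow
  | query ψ next ih =>
    rcases I.eq_empty_or_nonempty with rfl | ⟨i₀, hi₀⟩
    · simp
    obtain ⟨p, rfl⟩ : ∃ p, q = p + 1 := by
      have := hq i₀ hi₀
      simp only [numQueries] at this
      exact ⟨q - 1, by omega⟩
    -- Only inputs that receive the answer `a` are kept: the query bound says nothing about this
    -- branch on the others.
    have hbranch : ∀ a, ((I.filter fun i => O ((Φ i).and ψ) = a).image
        fun i => (next a).estimate O (Φ i)).card ≤ 2 ^ p := by
      intro a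
      refine ih a p _ fun i hi => ?_
      obtain ⟨hiI, rfl⟩ := Finset.mem_filter.1 hi
      simpa [numQueries] using hq i hiI
    have hsub : (I.image fun i => (query ψ next).estimate O (Φ i)) ⊆
        ((I.filter fun i => O ((Φ i).and ψ) = none).image
          fun i => (next none).estimate O (Φ i)) ∪
        ((I.filter fun i => O ((Φ i).and ψ) = O ψ).image
          fun i => (next (O ψ)).estimate O (Φ i)) := by
      intro x hx
      obtain ⟨i, hi, rfl⟩ := Finset.mem_image.1 hx
      rw [Finset.mem_union, Finset.mem_image, Finset.mem_image]
      rcases hΦ i ψ with h | h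
      · exact Or.inl ⟨i, Finset.mem_filter.2 ⟨hi, h⟩, by simp [estimate, h]⟩
      · exact Or.inr ⟨i, Finset.mem_filter.2 ⟨hi, h⟩, by simp [estimate, h]⟩
    have hcard := (Finset.card_le_card hsub).trans (Finset.card_union_le _ _)
    have h₁ := hbranch none
    have h₂ := hbranch (O ψ)
    rw [pow_succ]
    omega

/-- Powers of four are too far apart to share an approximation within a factor `1 + ε < 2`. -/
theorem exponent_le_of_common_approx {ε x : ℝ} (hε : ε ∈ Set.Ioo (0 : ℝ) 1) {i j : ℕ}
    (hi : x ≤ (1 + ε) * 4 ^ i) (hj : (4 : ℝ) ^ j / (1 + ε) ≤ x) : j ≤ i := by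
  obtain ⟨h0, h1⟩ := hε
  by_contra! hij
  have hpow : (4 : ℝ) ^ (i + 1) ≤ 4 ^ j := pow_le_pow_right₀ (by norm_num) hij
  have hle := hj.trans hi
  rw [div_le_iff₀ (by linarith)] at hle
  have hpos : (0 : ℝ) < 4 ^ i := by positivity
  rw [pow_succ] at hpow
  -- This is what dictates base four.
  have : (1 + ε) * (1 + ε) < 4 := by nlinarith
  nlinarith [mul_lt_mul_of_pos_right this hpos]

/-- An average number of occurring events is at most a pointwise bound on that number. -/
theorem sum_measureReal_le_of_card_le {Ω ι : Type*} [MeasurableSpace Ω] (μ : Measure Ω)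
    [IsProbabilityMeasure μ] (I : Finset ι) (E : ι → Set Ω) (hE : ∀ i, MeasurableSet (E i))
    [∀ ω, DecidablePred fun i => ω ∈ E i] (K : ℕ)
    (hK : ∀ ω, (I.filter fun i => ω ∈ E i).card ≤ K) :
    ∑ i ∈ I, μ.real (E i) ≤ K := by
  have hint : ∀ i ∈ I, Integrable ((E i).indicator (1 : Ω → ℝ)) μ := fun i _ =>
    (integrable_const (1 : ℝ)).indicator (hE i)
  calc ∑ i ∈ I, μ.real (E i) = ∫ ω, ∑ i ∈ I, (E i).indicator (1 : Ω → ℝ) ω ∂μ := by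
        rw [integral_finsetSum _ hint]
        exact Finset.sum_congr rfl fun i _ => (integral_indicator_one (hE i)).symm
    _ ≤ ∫ _, (K : ℝ) ∂μ := by
        refine integral_mono (integrable_finsetSum _ hint) (integrable_const _) fun ω => ?_
        simp only [Set.indicator_apply, Pi.one_apply, Finset.sum_boole]
        exact_mod_cast hK ω
    _ = K := by simp

/-- The counting bound: `n / 2 + 1` well-separated model counts have to be told apart by binary
answers. -/
theorem RandomizedCounter.mul_le_two_pow {n : ℕ} {Ω : Type*} [MeasurableSpace Ω] (μ : Measure Ω)
    [IsProbabilityMeasure μ] (alg : RandomizedCounter n Ω) {q : ℕ} {ε δ : ℝ}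
    (hε : ε ∈ Set.Ioo (0 : ℝ) 1) (hq : alg.MakesAtMost q) (happ : alg.Approximates μ ε δ) :
    ((n / 2 + 1 : ℕ) : ℝ) * (1 - δ) ≤ 2 ^ q := by
  classical
  choose Φ hΦ using fun j : ℕ => BoolFormula.exists_sol_eq (initialAssignments n (4 ^ j))
  let I := Finset.range (n / 2 + 1)
  have hcard : ∀ j ∈ I, ((Φ j).sol.card : ℝ) = 4 ^ j := by
    intro j hj
    have hj' : 2 * j ≤ n := by have := Finset.mem_range.1 hj; omega
    rw [hΦ, card_initialAssignments]
    · push_cast; rfl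
    · calc 4 ^ j = 2 ^ (2 * j) := by rw [pow_mul]; norm_num
        _ ≤ 2 ^ n := Nat.pow_le_pow_right (by norm_num) hj'
  let est : ℕ → Ω → ℝ := fun j ω => (alg.tree ω).estimate firstSolution (Φ j)
  let E : ℕ → Set Ω := fun j =>
    {ω | ((Φ j).sol.card : ℝ) / (1 + ε) ≤ est j ω ∧ est j ω ≤ (1 + ε) * ((Φ j).sol.card : ℝ)}
  have hE : ∀ j, MeasurableSet (E j) := fun j =>
    alg.measurable_estimate firstSolution (isSATOracle_firstSolution n) (Φ j) measurableSet_Icc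
  have hfew : ∀ ω, (I.filter fun j => ω ∈ E j).card ≤ 2 ^ q := by
    intro ω
    -- For fixed randomness, one estimate is correct for at most one `j`.
    have hinj : Set.InjOn (fun j => est j ω) (I.filter fun j => ω ∈ E j) := by
      intro i hi j hj hij
      obtain ⟨hi, hiE⟩ := Finset.mem_filter.1 hi
      obtain ⟨hj, hjE⟩ := Finset.mem_filter.1 hj
      simp only [E, Set.mem_ofPred_eq, hcard i hi, hcard j hj] at hiE hjE hij
      rw [hij] at hiE
      exact le_antisymm (exponent_le_of_common_approx hε hjE.2 hiE.1)
        (exponent_le_of_common_approx hε hiE.2 hjE.1)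
    rw [← Finset.card_image_of_injOn hinj]
    exact QueryTree.card_image_estimate_le firstSolution Φ
      (fun j ψ => firstSolution_and_of_initial (hΦ j) ψ) (alg.tree ω) q _
      fun j _ => hq firstSolution (isSATOracle_firstSolution n) (Φ j) ω
  calc ((n / 2 + 1 : ℕ) : ℝ) * (1 - δ) = ∑ _j ∈ I, (1 - δ) := by
        rw [Finset.sum_const, Finset.card_range, nsmul_eq_mul]
    _ ≤ ∑ j ∈ I, μ.real (E j) := Finset.sum_le_sum fun j _ =>
        happ firstSolution (isSATOracle_firstSolution n) (Φ j)
    _ ≤ ((2 ^ q : ℕ) : ℝ) := sum_measureReal_le_of_card_le μ I E hE _ hfew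
    _ = 2 ^ q := by push_cast; rfl

theorem theorem1 (ε δ : ℝ) (hε : ε ∈ Set.Ioo (0 : ℝ) 1) (hδ : δ ∈ Set.Ioo (0 : ℝ) 1) :
    ∃ c : ℝ, 0 < c ∧ ∃ N : ℕ, ∀ n : ℕ, N ≤ n →
      ∀ (Ω : Type*) [MeasurableSpace Ω] (μ : Measure Ω) [IsProbabilityMeasure μ]
        (alg : RandomizedCounter n Ω) (q : ℕ),
        alg.MakesAtMost q → alg.Approximates μ ε δ →
          c * (Real.log n / Real.log (Real.log n)) ≤ (q : ℝ) := by
  have hδ' : 0 < (1 - δ) / 2 := by linarith [hδ.2]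
  have hlog : Filter.Tendsto (fun n : ℕ => Real.log n) Filter.atTop Filter.atTop :=
    Real.tendsto_log_atTop.comp tendsto_natCast_atTop_atTop
  -- `log log n ≥ 1` lets the denominator be dropped; the second condition makes the loss from `log
  -- ((1 - δ) / 2)` at most half of `log n`, whence `c = 1 / 2`.
  obtain ⟨N, hN⟩ := Filter.eventually_atTop.1
    (((Real.tendsto_log_atTop.comp hlog).eventually_ge_atTop 1).and
      ((hlog.eventually_ge_atTop (-2 * Real.log ((1 - δ) / 2))).and
        ((hlog.eventually_ge_atTop 0).and (Filter.eventually_gt_atTop 0))))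
  refine ⟨1 / 2, by norm_num, N, fun n hn Ω _ μ _ alg q hq happ => ?_⟩
  obtain ⟨hloglog, hlarge, hnonneg, hpos⟩ := hN n hn
  have hpos' : (0 : ℝ) < n := by exact_mod_cast hpos
  have hhalf : (n : ℝ) / 2 ≤ ((n / 2 + 1 : ℕ) : ℝ) := by
    rw [div_le_iff₀ (by norm_num)]
    exact_mod_cast (by omega : n ≤ (n / 2 + 1) * 2)
  have hbound : (1 - δ) / 2 * n ≤ 2 ^ q := by
    refine le_trans ?_ (alg.mul_le_two_pow μ hε hq happ)
    nlinarith [mul_le_mul_of_nonneg_right hhalf (by linarith : (0 : ℝ) ≤ 1 - δ)]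
  have hlogbound := Real.log_le_log (by positivity) hbound
  rw [Real.log_mul hδ'.ne' hpos'.ne', Real.log_pow] at hlogbound
  have hlog2 : (q : ℝ) * Real.log 2 ≤ q :=
    mul_le_of_le_one_right (Nat.cast_nonneg q) (by linarith [Real.log_two_lt_d9])
  have hdiv : Real.log n / Real.log (Real.log n) ≤ Real.log n := div_le_self hnonneg hloglog
  linarith
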